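/- Let $A$ be an associative unital ring (for instance an algebra over a commutative ring $k$) and let $\mathfrak C$ be an $A$-coring, i.e. an $A$-bimodule with a coassociative coproduct $\Delta:\mathfrak C\to\mathfrak C\otimes_A\mathfrak C$ and a counit $\varepsilon:\mathfrak C\to A$, both bimodule maps. A right $\mathfrak C$-coaction on a right $A$-module $M$ is a right $A$-linear, coassociative and counital map $M\to M\otimes_A\mathfrak C$; a right $\mathfrak C$-comodule is a right $A$-module with a fixed coaction. For a right $\mathfrak C$-comodule $(M,\varrho^M)$ let $Z^1(\mathfrak C,M)$ be the set of all right $\mathfrak C$-coactions $F$ on the right $A$-module $M$. The group $\mathrm{Aut}_A(M)$ acts on it from the right by $(F,f)\mapsto (f^{-1}\otimes_A\mathfrak C)\circ F\circ f$, and $D^1(\mathfrak C,M)$ is the quotient of $Z^1(\mathfrak C,M)$ by this action, pointed by the class of $\varrho^M$. Let $(\Sigma,\varrho^\Sigma)$ be a right $\mathfrak C$-comodule and let $B=\mathrm{End}^{\mathfrak C}(\Sigma)$ be the ring of its comodule endomorphisms, which acts on $\Sigma$ from the left by evaluation. Suppose that $\Sigma$ is a Galois comodule, that is, $\Sigma$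 is finitely generated and projective as a right $A$-module and the evaluation map $\mathrm{Hom}^{\mathfrak C}(\Sigma,\mathfrak C)\otimes_B\Sigma\to\mathfrak C$, $f\otimes s\mapsto f(s)$, is an isomorphism of right $\mathfrak C$-comodules. Suppose also that $\Sigma$ is faithfully flat as a left $B$-module. Let $N$ be a right $B$-module. A $\Sigma$-twisted form of $N$ is a pair $(P,\phi)$ of a right $B$-module $P$ and a right $A$-module isomorphism $\phi:P\otimes_B\Sigma\to N\otimes_B\Sigma$; two such pairs $(P,\phi)$, $(Q,\psi)$ are equivalent if $P\cong Q$ as right $B$-modules. Let $\mathrm{Twist}_\Sigma(N)$ be the set of equivalence classes, pointed by the class of $(N,\mathrm{id}_{N\otimes_B\Sigma})$. Then, for every right $B$-module $N$, there is an isomorphism of pointed sets $$D^1(\mathfrak C,N\otimes_B\Sigma)\;\cong\;\mathrm{Twist}_\Sigma(N),$$ where $N\otimes_B\Sigma$ is a right $\mathfrak C$-comodule with the induced coaction $N\otimes_B\varrho^\Sigma$. -/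

import Mathlib

open MulOpposite
open scoped TensorProduct

universe u

noncomputable section

/-!
Right modules over a ring `R` are modules over `Rᵐᵒᵖ`, so that `m r` is written `op r • m`.
An `(R, S)`-bimodule carries `Module R`, `Module Sᵐᵒᵖ` and `SMulCommClass R Sᵐᵒᵖ`.
-/

/-! ### The tensor product over a non-commutative ring -/

/-- The subgroup of `M ⊗[ℤ] N` generated by the elements `m r ⊗ n - m ⊗ r n`. -/
def NCTensor.relations (R M N : Type*) [Ring R] [AddCommGroup M] [Module Rᵐᵒᵖ M]
    [AddCommGroup N] [Module R N] : AddSubgroup (M ⊗[ℤ] N) :=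
  AddSubgroup.closure
    {x | ∃ (m : M) (r : R) (n : N), x = (op r • m) ⊗ₜ[ℤ] n - m ⊗ₜ[ℤ] (r • n)}

/-- The tensor product over a ring `R` of a right `R`-module `M` and a left `R`-module `N`. -/
def NCTensor (R M N : Type*) [Ring R] [AddCommGroup M] [Module Rᵐᵒᵖ M]
    [AddCommGroup N] [Module R N] : Type _ :=
  (M ⊗[ℤ] N) ⧸ NCTensor.relations R M N

namespace NCTensor

section Basic

variable {R M N P M' N' M'' N'' : Type*} [Ring R]
  [AddCommGroup M] [Module Rᵐᵒᵖ M] [AddCommGroup N] [Module R N] [AddCommGroup P]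
  [AddCommGroup M'] [Module Rᵐᵒᵖ M'] [AddCommGroup N'] [Module R N']
  [AddCommGroup M''] [Module Rᵐᵒᵖ M''] [AddCommGroup N''] [Module R N'']

instance : AddCommGroup (NCTensor R M N) :=
  inferInstanceAs (AddCommGroup ((M ⊗[ℤ] N) ⧸ NCTensor.relations R M N))

variable (R) in
/-- The pure tensor `m ⊗ n`. -/
def tmul (m : M) (n : N) : NCTensor R M N :=
  QuotientAddGroup.mk' (NCTensor.relations R M N) (m ⊗ₜ[ℤ] n)

theorem add_tmul (m m' : M) (n : N) : tmul R (m + m') n = tmul R m n + tmul R m' n := by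
  simp only [tmul, TensorProduct.add_tmul, map_add]
  rfl

theorem tmul_add (m : M) (n n' : N) : tmul R m (n + n') = tmul R m n + tmul R m n' := by
  simp only [tmul, TensorProduct.tmul_add, map_add]
  rfl

theorem smul_tmul (r : R) (m : M) (n : N) : tmul R (op r • m) n = tmul R m (r • n) := by
  refine sub_eq_zero.1 ?_
  exact (QuotientAddGroup.eq_zero_iff (N := NCTensor.relations R M N)
    ((op r • m) ⊗ₜ[ℤ] n - m ⊗ₜ[ℤ] (r • n))).2
    (AddSubgroup.subset_closure ⟨m, r, n, rfl⟩)

theorem zero_tmul (n : N) : tmul R (0 : M) n = 0 := by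
  have h := add_tmul (R := R) (0 : M) 0 n
  simpa using h

theorem tmul_zero (m : M) : tmul R m (0 : N) = 0 := by
  have h := tmul_add (R := R) m (0 : N) 0
  simpa using h

@[elab_as_elim]
theorem induction_on {motive : NCTensor R M N → Prop} (x : NCTensor R M N)
    (zero : motive 0) (tmul : ∀ m n, motive (tmul R m n))
    (add : ∀ x y, motive x → motive y → motive (x + y)) : motive x := by
  obtain ⟨y, rfl⟩ := QuotientAddGroup.mk'_surjective _ x
  induction y using TensorProduct.induction_on with
  | zero => exact zero
  | tmul m n => exact tmul m n
  | add a b ha hb => exact add _ _ ha hb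

/-- The additive map out of `M ⊗ N` given by a biadditive `R`-balanced map. -/
def lift (f : M →+ N →+ P) (hf : ∀ (m : M) (r : R) (n : N), f (op r • m) n = f m (r • n)) :
    NCTensor R M N →+ P :=
  QuotientAddGroup.lift (NCTensor.relations R M N)
    (TensorProduct.liftAddHom f (fun z m n => by simp))
    (by
      rw [NCTensor.relations, AddSubgroup.closure_le]
      rintro _ ⟨m, r, n, rfl⟩
      simp [hf])

@[simp]
theorem lift_tmul (f : M →+ N →+ P)
    (hf : ∀ (m : M) (r : R) (n : N), f (op r • m) n = f m (r • n)) (m : M) (n : N) :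
    lift f hf (tmul R m n) = f m n :=
  rfl

theorem hom_ext {f g : NCTensor R M N →+ P} (h : ∀ m n, f (tmul R m n) = g (tmul R m n)) :
    f = g := by
  ext x
  induction x using induction_on with
  | zero => simp
  | tmul m n => exact h m n
  | add x y hx hy => simp only [map_add, hx, hy]

/-- The map `f ⊗ g`. -/
def map (f : M →ₗ[Rᵐᵒᵖ] M') (g : N →ₗ[R] N') : NCTensor R M N →+ NCTensor R M' N' :=
  lift
    (AddMonoidHom.mk'
      (fun m => AddMonoidHom.mk' (fun n => tmul R (f m) (g n))
        (fun a b => by rw [map_add, tmul_add]))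
      (fun a b => by ext n; simp [add_tmul]))
    (fun m r n => by simp [smul_tmul])

@[simp]
theorem map_tmul (f : M →ₗ[Rᵐᵒᵖ] M') (g : N →ₗ[R] N') (m : M) (n : N) :
    map f g (tmul R m n) = tmul R (f m) (g n) :=
  rfl

theorem map_map (f' : M' →ₗ[Rᵐᵒᵖ] M'') (g' : N' →ₗ[R] N'') (f : M →ₗ[Rᵐᵒᵖ] M')
    (g : N →ₗ[R] N') (x : NCTensor R M N) :
    map f' g' (map f g x) = map (f' ∘ₗ f) (g' ∘ₗ g) x :=
  DFunLike.congr_fun (hom_ext (f := (map f' g').comp (map f g))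
    (g := map (f' ∘ₗ f) (g' ∘ₗ g)) (fun _ _ => rfl)) x

theorem map_id_id (x : NCTensor R M N) :
    map (LinearMap.id : M →ₗ[Rᵐᵒᵖ] M) (LinearMap.id : N →ₗ[R] N) x = x :=
  DFunLike.congr_fun (hom_ext (f := map LinearMap.id LinearMap.id)
    (g := AddMonoidHom.id (NCTensor R M N)) (fun _ _ => rfl)) x

/-- The canonical map `R ⊗ N → N`. -/
def lid : NCTensor R R N →+ N :=
  lift (AddMonoidHom.mk' (fun r => AddMonoidHom.mk' (fun n => r • n) (smul_add r))
      (fun a b => by ext n; simp [add_smul]))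
    (fun m r n => by simp [mul_smul])

@[simp]
theorem lid_tmul (r : R) (n : N) : lid (tmul R r n) = r • n :=
  rfl

/-- The canonical map `M ⊗ R → M`. -/
def rid : NCTensor R M R →+ M :=
  lift (AddMonoidHom.mk' (fun m => AddMonoidHom.mk' (fun r => op r • m)
        (fun a b => by simp [add_smul]))
      (fun a b => by ext n; simp))
    (fun m r n => by simp [mul_smul])

@[simp]
theorem rid_tmul (m : M) (r : R) : rid (tmul R m r) = op r • m :=
  rfl

end Basic

section Actions

variable {R S T M N M' N' : Type*} [Ring R] [Ring S] [Ring T]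
  [AddCommGroup M] [Module Rᵐᵒᵖ M] [AddCommGroup N] [Module R N]
  [AddCommGroup M'] [Module Rᵐᵒᵖ M'] [AddCommGroup N'] [Module R N']

/-- If `M` is an `(S, R)`-bimodule, then `M ⊗ N` is a left `S`-module. -/
instance leftModule [Module S M] [SMulCommClass S Rᵐᵒᵖ M] : Module S (NCTensor R M N) where
  smul s := map (DistribSMul.toLinearMap Rᵐᵒᵖ M s) LinearMap.id
  one_smul x := by
    change map _ _ x = x
    induction x using induction_on with
    | zero => simp
    | tmul m n => simp
    | add x y hx hy => simp only [map_add, hx, hy]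
  mul_smul s t x := by
    change map _ _ x = map _ _ (map _ _ x)
    induction x using induction_on with
    | zero => simp
    | tmul m n => simp [mul_smul]
    | add x y hx hy => simp only [map_add, hx, hy]
  smul_zero s := map_zero _
  smul_add s := map_add _
  add_smul s t x := by
    change map _ _ x = map _ _ x + map _ _ x
    induction x using induction_on with
    | zero => simp
    | tmul m n => simp [add_smul, add_tmul]
    | add x y hx hy => simp only [map_add, hx, hy]; abel
  zero_smul x := by
    change map _ _ x = 0
    induction x using induction_on with
    | zero => simp
    | tmul m n => simp [zero_tmul]
    | add x y hx hy => simp only [map_add, hx, hy, add_zero]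

theorem smul_def_left [Module S M] [SMulCommClass S Rᵐᵒᵖ M] (s : S) (m : M) (n : N) :
    s • tmul R m n = tmul R (s • m) n :=
  rfl

/-- If `N` is an `(R, T)`-bimodule, then `M ⊗ N` is a right `T`-module. -/
instance rightModule [Module Tᵐᵒᵖ N] [SMulCommClass R Tᵐᵒᵖ N] :
    Module Tᵐᵒᵖ (NCTensor R M N) where
  smul t := map LinearMap.id
    { toFun := fun n => t • n
      map_add' := smul_add t
      map_smul' := fun r n => (smul_comm r t n).symm }
  one_smul x := by
    change map _ _ x = x
    induction x using induction_on with
    | zero => simp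
    | tmul m n => simp
    | add x y hx hy => simp only [map_add, hx, hy]
  mul_smul s t x := by
    change map _ _ x = map _ _ (map _ _ x)
    induction x using induction_on with
    | zero => simp
    | tmul m n => simp [mul_smul]
    | add x y hx hy => simp only [map_add, hx, hy]
  smul_zero s := map_zero _
  smul_add s := map_add _
  add_smul s t x := by
    change map _ _ x = map _ _ x + map _ _ x
    induction x using induction_on with
    | zero => simp
    | tmul m n => simp [add_smul, tmul_add]
    | add x y hx hy => simp only [map_add, hx, hy]; abel
  zero_smul x := by
    change map _ _ x = 0
    induction x using induction_on with
    | zero => simp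
    | tmul m n => simp [tmul_zero]
    | add x y hx hy => simp only [map_add, hx, hy, add_zero]

theorem smul_def_right [Module Tᵐᵒᵖ N] [SMulCommClass R Tᵐᵒᵖ N] (t : Tᵐᵒᵖ) (m : M) (n : N) :
    t • tmul R m n = tmul R m (t • n) :=
  rfl

instance [Module S M] [SMulCommClass S Rᵐᵒᵖ M] [Module Tᵐᵒᵖ N] [SMulCommClass R Tᵐᵒᵖ N] :
    SMulCommClass S Tᵐᵒᵖ (NCTensor R M N) where
  smul_comm s t x := by
    induction x using induction_on with
    | zero => simp
    | tmul m n => rfl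
    | add x y hx hy => simp only [smul_add, hx, hy]

/-- `f ⊗ N` as a right `T`-linear map, for an `(R, T)`-bimodule `N`. -/
def rTensor (N : Type*) [AddCommGroup N] [Module R N] [Module Tᵐᵒᵖ N] [SMulCommClass R Tᵐᵒᵖ N]
    (f : M →ₗ[Rᵐᵒᵖ] M') : NCTensor R M N →ₗ[Tᵐᵒᵖ] NCTensor R M' N where
  toFun := map f LinearMap.id
  map_add' := map_add _
  map_smul' t x := by
    induction x using induction_on with
    | zero => simp
    | tmul m n => rfl
    | add x y hx hy => simp only [smul_add, map_add, hx, hy]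

end Actions

section Assoc

variable {R S M N P M' N' P' : Type*} [Ring R] [Ring S]
  [AddCommGroup M] [Module Rᵐᵒᵖ M]
  [AddCommGroup N] [Module R N] [Module Sᵐᵒᵖ N] [SMulCommClass R Sᵐᵒᵖ N]
  [AddCommGroup P] [Module S P]

/-- The biadditive map `(m ⊗ n, p) ↦ m ⊗ (n ⊗ p)`. -/
def assocAux : NCTensor R M N →+ P →+ NCTensor R M (NCTensor S N P) :=
  lift
    (AddMonoidHom.mk'
      (fun m => AddMonoidHom.mk'
        (fun n => AddMonoidHom.mk' (fun p => tmul R m (tmul S n p))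
          (fun a b => by rw [tmul_add, tmul_add]))
        (fun a b => AddMonoidHom.ext (fun p => by
          change tmul R m (tmul S (a + b) p) = tmul R m (tmul S a p) + tmul R m (tmul S b p)
          rw [add_tmul, tmul_add])))
      (fun a b => AddMonoidHom.ext (fun n => AddMonoidHom.ext (fun p => add_tmul a b _))))
    (fun m r n => AddMonoidHom.ext (fun p => smul_tmul r m (tmul S n p)))

/-- The canonical map `(M ⊗ N) ⊗ P → M ⊗ (N ⊗ P)`. -/
def assocHom : NCTensor S (NCTensor R M N) P →+ NCTensor R M (NCTensor S N P) :=
  lift assocAux (fun x s p => by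
    induction x using induction_on with
    | zero => rw [smul_zero, map_zero, AddMonoidHom.zero_apply, AddMonoidHom.zero_apply]
    | tmul m n => exact congrArg (tmul R m) (smul_tmul s n p)
    | add x y hx hy => simp only [smul_add, map_add, AddMonoidHom.add_apply, hx, hy])

/-- The biadditive map `(m, n ⊗ p) ↦ (m ⊗ n) ⊗ p`. -/
def assocInvAux : M →+ NCTensor S N P →+ NCTensor S (NCTensor R M N) P :=
  AddMonoidHom.mk'
    (fun m => lift
      (AddMonoidHom.mk'
        (fun n => AddMonoidHom.mk' (fun p => tmul S (tmul R m n) p) (tmul_add _))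
        (fun a b => AddMonoidHom.ext (fun p => by
          change tmul S (tmul R m (a + b)) p = tmul S (tmul R m a) p + tmul S (tmul R m b) p
          rw [tmul_add, add_tmul])))
      (fun n s p => smul_tmul s (tmul R m n) p))
    (fun a b => hom_ext (fun n p => by
      change tmul S (tmul R (a + b) n) p = tmul S (tmul R a n) p + tmul S (tmul R b n) p
      rw [add_tmul, add_tmul]))

/-- The canonical map `M ⊗ (N ⊗ P) → (M ⊗ N) ⊗ P`. -/
def assocInv : NCTensor R M (NCTensor S N P) →+ NCTensor S (NCTensor R M N) P :=
  lift assocInvAux (fun m r x => by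
    induction x using induction_on with
    | zero => rw [smul_zero, map_zero, map_zero]
    | tmul n p => exact congrArg (fun y => tmul S y p) (smul_tmul r m n)
    | add x y hx hy => simp only [smul_add, map_add, hx, hy])

@[simp]
theorem assocHom_tmul (m : M) (n : N) (p : P) :
    assocHom (tmul S (tmul R m n) p) = tmul R m (tmul S n p) :=
  rfl

@[simp]
theorem assocInv_tmul (m : M) (n : N) (p : P) :
    assocInv (tmul R m (tmul S n p)) = tmul S (tmul R m n) p :=
  rfl

theorem assoc_ext {Q : Type*} [AddCommGroup Q] {f g : NCTensor S (NCTensor R M N) P →+ Q}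
    (h : ∀ m n p, f (tmul S (tmul R m n) p) = g (tmul S (tmul R m n) p)) : f = g := by
  refine hom_ext (fun x p => ?_)
  induction x using induction_on with
  | zero => rw [zero_tmul, map_zero, map_zero]
  | tmul m n => exact h m n p
  | add x y hx hy => simp only [add_tmul, map_add, hx, hy]

theorem assoc_ext' {Q : Type*} [AddCommGroup Q] {f g : NCTensor R M (NCTensor S N P) →+ Q}
    (h : ∀ m n p, f (tmul R m (tmul S n p)) = g (tmul R m (tmul S n p))) : f = g := by
  refine hom_ext (fun m x => ?_)
  induction x using induction_on with
  | zero => rw [tmul_zero, map_zero, map_zero]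
  | tmul n p => exact h m n p
  | add x y hx hy => simp only [tmul_add, map_add, hx, hy]

variable (R S M N P) in
/-- The associativity isomorphism `(M ⊗ N) ⊗ P ≃ M ⊗ (N ⊗ P)`. -/
def assoc : NCTensor S (NCTensor R M N) P ≃+ NCTensor R M (NCTensor S N P) where
  toFun := assocHom
  invFun := assocInv
  left_inv x := DFunLike.congr_fun
    (assoc_ext (f := assocInv.comp assocHom)
      (g := AddMonoidHom.id (NCTensor S (NCTensor R M N) P)) (fun _ _ _ => rfl)) x
  right_inv x := DFunLike.congr_fun
    (assoc_ext' (f := assocHom.comp assocInv)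
      (g := AddMonoidHom.id (NCTensor R M (NCTensor S N P))) (fun _ _ _ => rfl)) x
  map_add' := map_add _

@[simp]
theorem assoc_tmul (m : M) (n : N) (p : P) :
    assoc R S M N P (tmul S (tmul R m n) p) = tmul R m (tmul S n p) :=
  rfl

@[simp]
theorem assoc_symm_tmul (m : M) (n : N) (p : P) :
    (assoc R S M N P).symm (tmul R m (tmul S n p)) = tmul S (tmul R m n) p :=
  rfl

theorem assoc_map {M' : Type*} [AddCommGroup M'] [Module Rᵐᵒᵖ M'] (f : M →ₗ[Rᵐᵒᵖ] M')
    (x : NCTensor S (NCTensor R M N) P) :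
    assoc R S M' N P (map (rTensor N f) LinearMap.id x) =
      map f LinearMap.id (assoc R S M N P x) :=
  DFunLike.congr_fun (assoc_ext
    (f := (assoc R S M' N P).toAddMonoidHom.comp (map (rTensor N f) LinearMap.id))
    (g := (map f LinearMap.id).comp (assoc R S M N P).toAddMonoidHom) (fun _ _ _ => rfl)) x

end Assoc

/-- A left `B`-module `Q` is faithfully flat if a sequence of right `B`-modules is exact
if and only if its tensor product with `Q` is exact. -/
def FaithfullyFlat (B Q : Type u) [Ring B] [AddCommGroup Q] [Module B Q] : Prop :=
  ∀ (X Y Z : Type u) [AddCommGroup X] [AddCommGroup Y] [AddCommGroup Z]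
    [Module Bᵐᵒᵖ X] [Module Bᵐᵒᵖ Y] [Module Bᵐᵒᵖ Z]
    (f : X →ₗ[Bᵐᵒᵖ] Y) (g : Y →ₗ[Bᵐᵒᵖ] Z),
    Function.Exact f g ↔
      Function.Exact (map f (LinearMap.id : Q →ₗ[B] Q)) (map g (LinearMap.id : Q →ₗ[B] Q))

end NCTensor

open NCTensor

/-! ### Corings and comodules -/

/-- Homomorphisms of `(R, S)`-bimodules. -/
structure BimodHom (R S M N : Type*) [Ring R] [Ring S] [AddCommGroup M] [Module R M]
    [Module Sᵐᵒᵖ M] [AddCommGroup N] [Module R N] [Module Sᵐᵒᵖ N] where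
  /-- The underlying left linear map. -/
  left : M →ₗ[R] N
  map_op_smul : ∀ (s : Sᵐᵒᵖ) (m : M), left (s • m) = s • left m

/-- The underlying right linear map of a bimodule homomorphism. -/
def BimodHom.right {R S M N : Type*} [Ring R] [Ring S] [AddCommGroup M] [Module R M]
    [Module Sᵐᵒᵖ M] [AddCommGroup N] [Module R N] [Module Sᵐᵒᵖ N] (f : BimodHom R S M N) :
    M →ₗ[Sᵐᵒᵖ] N where
  toFun := f.left
  map_add' := map_add f.left
  map_smul' := f.map_op_smul

/-- An `A`-coring: an `A`-bimodule `C` with a coassociative and counital bimodule coproduct. -/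
class Coring (A C : Type*) [Ring A] [AddCommGroup C] [Module A C] [Module Aᵐᵒᵖ C]
    [SMulCommClass A Aᵐᵒᵖ C] where
  /-- The coproduct. -/
  comul : BimodHom A A C (NCTensor A C C)
  /-- The counit. -/
  counit : BimodHom A A C A
  coassoc : ∀ c : C, assoc A A C C C (map comul.right LinearMap.id (comul.left c)) =
    map LinearMap.id comul.left (comul.left c)
  counit_left : ∀ c : C, lid (map counit.right LinearMap.id (comul.left c)) = c
  counit_right : ∀ c : C, rid (map LinearMap.id counit.left (comul.left c)) = c

/-- The right `C`-coactions on the right `A`-module `M`. This type is also the set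
`Z¹(C, M)` of descent `1`-cocycles. -/
@[ext]
structure Coaction (A C M : Type*) [Ring A] [AddCommGroup C] [Module A C] [Module Aᵐᵒᵖ C]
    [SMulCommClass A Aᵐᵒᵖ C] [Coring A C] [AddCommGroup M] [Module Aᵐᵒᵖ M] where
  /-- The coaction as a right `A`-linear map. -/
  toLin : M →ₗ[Aᵐᵒᵖ] NCTensor A M C
  coassoc : ∀ m : M, assoc A A M C C (map toLin LinearMap.id (toLin m)) =
    map LinearMap.id (Coring.comul (A := A) (C := C)).left (toLin m)
  counit : ∀ m : M, rid (map LinearMap.id (Coring.counit (A := A) (C := C)).left (toLin m)) = m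

namespace Coaction

section Comodules

variable {A C M X Y : Type*} [Ring A] [AddCommGroup C] [Module A C] [Module Aᵐᵒᵖ C]
  [SMulCommClass A Aᵐᵒᵖ C] [Coring A C]
  [AddCommGroup M] [Module Aᵐᵒᵖ M] [AddCommGroup X] [Module Aᵐᵒᵖ X]
  [AddCommGroup Y] [Module Aᵐᵒᵖ Y]

variable (A C) in
/-- `C` as a right comodule over itself. -/
def regular : Coaction A C C where
  toLin := (Coring.comul (A := A) (C := C)).right
  coassoc := Coring.coassoc
  counit := Coring.counit_right

/-- The condition `ρ^Y ∘ f = (f ⊗ C) ∘ ρ^X`. -/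
def IsColinear (ρX : Coaction A C X) (ρY : Coaction A C Y) (f : X →ₗ[Aᵐᵒᵖ] Y) : Prop :=
  ∀ x, ρY.toLin (f x) = map f LinearMap.id (ρX.toLin x)

/-- The group `Hom^C(X, Y)` of homomorphisms of right `C`-comodules. -/
def hom (ρX : Coaction A C X) (ρY : Coaction A C Y) : AddSubgroup (X →ₗ[Aᵐᵒᵖ] Y) where
  carrier := {f | IsColinear ρX ρY f}
  zero_mem' x := by
    have h : map (0 : X →ₗ[Aᵐᵒᵖ] Y) (LinearMap.id : C →ₗ[A] C) = 0 := hom_ext (fun m n => by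
      simp [zero_tmul])
    simp [h]
  add_mem' {f g} hf hg x := by
    have h : map (f + g) (LinearMap.id : C →ₗ[A] C)
        = map f LinearMap.id + map g LinearMap.id := hom_ext (fun m n => by simp [add_tmul])
    simp [h, hf x, hg x]
  neg_mem' {f} hf x := by
    have h : map (-f) (LinearMap.id : C →ₗ[A] C) = - map f LinearMap.id := hom_ext (fun m n => by
      rw [AddMonoidHom.neg_apply, eq_neg_iff_add_eq_zero, map_tmul, map_tmul, ← add_tmul]
      simp [zero_tmul])
    simp [h, hf x]

/-- The ring `End^C(X)` of endomorphisms of a right `C`-comodule, with composition. -/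
def endRing (ρ : Coaction A C X) : Subring (Module.End Aᵐᵒᵖ X) where
  carrier := {f | IsColinear ρ ρ f}
  mul_mem' {f g} hf hg x := by
    rw [Module.End.mul_apply, hf, hg, map_map]
    rfl
  one_mem' x := (map_id_id _).symm
  add_mem' hf hg := (hom ρ ρ).add_mem hf hg
  zero_mem' := (hom ρ ρ).zero_mem
  neg_mem' hf := (hom ρ ρ).neg_mem hf

/-- `Hom^C(X, Y)` is a right `End^C(X)`-module by composition. -/
instance homModule (ρX : Coaction A C X) (ρY : Coaction A C Y) :
    Module (endRing ρX)ᵐᵒᵖ (hom ρX ρY) where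
  smul b f := ⟨f.1 ∘ₗ (unop b).1, fun x => by
    rw [LinearMap.comp_apply, f.2, (unop b).2, map_map]
    rfl⟩
  one_smul f := rfl
  mul_smul b c f := rfl
  smul_zero b := rfl
  smul_add b f g := rfl
  add_smul b c f := Subtype.ext (LinearMap.ext (fun x => map_add f.1 _ _))
  zero_smul f := Subtype.ext (LinearMap.ext (fun x => map_zero f.1))

/-- The map `N ⊗ ρ : N ⊗_B Q → (N ⊗_B Q) ⊗_A C`, for a `(B, A)`-bimodule `Q` with a left
`B`-linear and right `A`-linear map `ρ : Q → Q ⊗_A C`. -/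
def inducedLin {B Q : Type*} [Ring B] [AddCommGroup Q] [Module B Q] [Module Aᵐᵒᵖ Q]
    [SMulCommClass B Aᵐᵒᵖ Q] (ρ : Q →ₗ[Aᵐᵒᵖ] NCTensor A Q C)
    (hρ : ∀ (b : B) (q : Q), ρ (b • q) = b • ρ q)
    (N : Type*) [AddCommGroup N] [Module Bᵐᵒᵖ N] :
    NCTensor B N Q →ₗ[Aᵐᵒᵖ] NCTensor A (NCTensor B N Q) C where
  toFun x := (assoc B A N Q C).symm
    (map LinearMap.id { toFun := ρ, map_add' := map_add ρ, map_smul' := hρ } x)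
  map_add' x y := by simp only [map_add]
  map_smul' a x := by
    have key : ∀ y : NCTensor B N (NCTensor A Q C),
        (assoc B A N Q C).symm (a • y) = a • (assoc B A N Q C).symm y := by
      intro y
      induction y using NCTensor.induction_on with
      | zero => simp only [smul_zero, map_zero]
      | tmul n z =>
        rw [smul_def_right]
        induction z using NCTensor.induction_on with
        | zero => simp only [smul_zero, tmul_zero, map_zero]
        | tmul q c => rfl
        | add x y hx hy => simp only [smul_add, tmul_add, map_add, hx, hy]
      | add x y hx hy => simp only [smul_add, map_add, hx, hy]
    rw [RingHom.id_apply, ← key]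
    congr 1
    induction x using NCTensor.induction_on with
    | zero => simp only [smul_zero, map_zero]
    | tmul n q => exact congrArg (tmul B n) (ρ.map_smul a q)
    | add x y hx hy => simp only [smul_add, map_add, hx, hy]

/-- For a `(B, A)`-bimodule `Q` with left `B`-linear right coaction `ρ`, the induced coaction
`N ⊗ ρ` on `N ⊗_B Q`. -/
def induced {B Q : Type*} [Ring B] [AddCommGroup Q] [Module B Q] [Module Aᵐᵒᵖ Q]
    [SMulCommClass B Aᵐᵒᵖ Q] (ρ : Coaction A C Q)
    (hρ : ∀ (b : B) (q : Q), ρ.toLin (b • q) = b • ρ.toLin q)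
    (N : Type*) [AddCommGroup N] [Module Bᵐᵒᵖ N] : Coaction A C (NCTensor B N Q) where
  toLin := inducedLin ρ.toLin hρ N
  coassoc x := by
    induction x using NCTensor.induction_on with
    | zero => simp only [map_zero]
    | add x y hx hy => simp only [map_add, hx, hy]
    | tmul n q =>
      -- `n ⊗ -` as a right linear map `Q → N ⊗ Q`
      let j : Q →ₗ[Aᵐᵒᵖ] NCTensor B N Q :=
        { toFun := fun q => tmul B n q, map_add' := tmul_add n, map_smul' := fun _ _ => rfl }
      have hj : ∀ q, inducedLin ρ.toLin hρ N (j q) = map j LinearMap.id (ρ.toLin q) := by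
        intro q
        change (assoc B A N Q C).symm (tmul B n (ρ.toLin q)) = _
        induction ρ.toLin q using NCTensor.induction_on with
        | zero => simp only [tmul_zero, map_zero]
        | tmul q c => rfl
        | add x y hx hy => simp only [tmul_add, map_add, hx, hy]
      have hj' : inducedLin ρ.toLin hρ N ∘ₗ j = rTensor C j ∘ₗ ρ.toLin := LinearMap.ext hj
      change assoc A A _ C C (map _ _ (inducedLin ρ.toLin hρ N (j q))) =
        map _ _ (inducedLin ρ.toLin hρ N (j q))
      rw [hj, map_map, hj']
      have h1 : map (rTensor C j ∘ₗ ρ.toLin) (LinearMap.id ∘ₗ LinearMap.id) (ρ.toLin q)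
          = map (rTensor C j) (LinearMap.id : C →ₗ[A] C)
              (map ρ.toLin LinearMap.id (ρ.toLin q)) := (map_map _ _ _ _ _).symm
      rw [h1, assoc_map, ρ.coassoc, map_map, map_map]
      rfl
  counit x := by
    induction x using NCTensor.induction_on with
    | zero => simp only [map_zero]
    | add x y hx hy => simp only [map_add, hx, hy]
    | tmul n q =>
      conv_rhs => rw [← ρ.counit q]
      change rid (map _ _ ((assoc B A N Q C).symm (tmul B n (ρ.toLin q)))) = _
      induction ρ.toLin q using NCTensor.induction_on with
      | zero => simp only [tmul_zero, map_zero]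
      | tmul q c => rfl
      | add x y hx hy => simp only [tmul_add, map_add, hx, hy]

/-- The coaction of a comodule is left linear over its endomorphism ring. -/
theorem toLin_end_smul (ρ : Coaction A C X) (b : endRing ρ) (x : X) :
    ρ.toLin (b • x) = b • ρ.toLin x :=
  b.2 x

/-- The pulled back coaction `f^*(F) = (f⁻¹ ⊗ C) ∘ F ∘ f` along a right `A`-linear isomorphism. -/
def pullback (f : X ≃ₗ[Aᵐᵒᵖ] Y) (F : Coaction A C Y) : Coaction A C X where
  toLin := rTensor C f.symm.toLinearMap ∘ₗ F.toLin ∘ₗ f.toLinearMap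
  coassoc x := by
    have h1 : (rTensor C f.symm.toLinearMap ∘ₗ F.toLin ∘ₗ f.toLinearMap) ∘ₗ f.symm.toLinearMap
        = rTensor C f.symm.toLinearMap ∘ₗ F.toLin := by
      ext y
      simp
    change assoc A A _ C C (map _ _ (map f.symm.toLinearMap LinearMap.id (F.toLin (f x)))) =
      map _ _ (map f.symm.toLinearMap LinearMap.id (F.toLin (f x)))
    rw [map_map, h1]
    have h2 : map (rTensor C f.symm.toLinearMap ∘ₗ F.toLin) (LinearMap.id ∘ₗ LinearMap.id)
          (F.toLin (f x))
        = map (rTensor C f.symm.toLinearMap) (LinearMap.id : C →ₗ[A] C)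
            (map F.toLin LinearMap.id (F.toLin (f x))) := (map_map _ _ _ _ _).symm
    rw [h2, assoc_map, F.coassoc, map_map, map_map]
    rfl
  counit x := by
    have h : ∀ z : NCTensor A Y C,
        rid (map LinearMap.id (Coring.counit (A := A) (C := C)).left
          (map f.symm.toLinearMap LinearMap.id z)) =
        f.symm (rid (map LinearMap.id (Coring.counit (A := A) (C := C)).left z)) := by
      intro z
      induction z using NCTensor.induction_on with
      | zero => simp only [map_zero]
      | tmul y c => exact (f.symm.map_smul _ y).symm
      | add x y hx hy => simp only [map_add, hx, hy]
    refine (h (F.toLin (f x))).trans ?_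
    rw [F.counit, LinearEquiv.symm_apply_apply]

/-- The right action `(F, f) ↦ f^*(F)` of `Aut_A(M)` on `Z¹(C, M)`. -/
instance autAction : MulAction (M ≃ₗ[Aᵐᵒᵖ] M)ᵐᵒᵖ (Coaction A C M) where
  smul f F := pullback (unop f) F
  one_smul F := by
    ext x
    exact map_id_id _
  mul_smul f g F := by
    ext x
    change map _ _ _ = map _ _ (map _ _ _)
    rw [map_map]
    rfl

end Comodules

end Coaction

open Coaction

/-- The first descent cohomology set `D¹(C, M)`. -/
def DescentD1 (A C M : Type*) [Ring A] [AddCommGroup C] [Module A C] [Module Aᵐᵒᵖ C]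
    [SMulCommClass A Aᵐᵒᵖ C] [Coring A C] [AddCommGroup M] [Module Aᵐᵒᵖ M] : Type _ :=
  MulAction.orbitRel.Quotient (M ≃ₗ[Aᵐᵒᵖ] M)ᵐᵒᵖ (Coaction A C M)

/-- The class in `D¹(C, M)` of a coaction. The class of the given coaction of a comodule `M` is
the distinguished point. -/
def DescentD1.mk {A C M : Type*} [Ring A] [AddCommGroup C] [Module A C] [Module Aᵐᵒᵖ C]
    [SMulCommClass A Aᵐᵒᵖ C] [Coring A C] [AddCommGroup M] [Module Aᵐᵒᵖ M]
    (F : Coaction A C M) : DescentD1 A C M :=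
  Quotient.mk (MulAction.orbitRel (M ≃ₗ[Aᵐᵒᵖ] M)ᵐᵒᵖ (Coaction A C M)) F

/-! ### Twisted forms -/

/-- A `Q`-twisted form of `N`, for a `(B, A)`-bimodule `Q` and a right `B`-module `N`: a right
`B`-module `P` with a right `A`-linear isomorphism `P ⊗_B Q ≃ N ⊗_B Q`. -/
structure TwistedForm (A B Q N : Type u) [Ring A] [Ring B] [AddCommGroup Q] [Module B Q]
    [Module Aᵐᵒᵖ Q] [SMulCommClass B Aᵐᵒᵖ Q] [AddCommGroup N] [Module Bᵐᵒᵖ N] where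
  /-- The underlying right module. -/
  carrier : Type u
  [addCommGroup : AddCommGroup carrier]
  [module : Module Bᵐᵒᵖ carrier]
  /-- The right `A`-linear isomorphism. -/
  iso : NCTensor B carrier Q ≃ₗ[Aᵐᵒᵖ] NCTensor B N Q

attribute [instance] TwistedForm.addCommGroup TwistedForm.module

section Twist

variable (A B Q N : Type u) [Ring A] [Ring B] [AddCommGroup Q] [Module B Q]
    [Module Aᵐᵒᵖ Q] [SMulCommClass B Aᵐᵒᵖ Q] [AddCommGroup N] [Module Bᵐᵒᵖ N]

/-- Twisted forms are equivalent if the underlying right `B`-modules are isomorphic. -/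
def TwistedForm.setoid : Setoid (TwistedForm A B Q N) where
  r P P' := Nonempty (P.carrier ≃ₗ[Bᵐᵒᵖ] P'.carrier)
  iseqv :=
    { refl := fun _ => ⟨LinearEquiv.refl _ _⟩
      symm := fun ⟨e⟩ => ⟨e.symm⟩
      trans := fun ⟨e⟩ ⟨e'⟩ => ⟨e.trans e'⟩ }

/-- The set of equivalence classes of `Q`-twisted forms of `N`. -/
def Twist : Type (u + 1) :=
  Quotient (TwistedForm.setoid A B Q N)

/-- The distinguished point of `Twist`: the class of `N` with the identity map. -/
def Twist.point : Twist A B Q N :=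
  Quotient.mk (TwistedForm.setoid A B Q N) ⟨N, LinearEquiv.refl _ _⟩

end Twist

/-! ### Galois comodules -/

namespace Coaction

variable {A C Q : Type*} [Ring A] [AddCommGroup C] [Module A C] [Module Aᵐᵒᵖ C]
  [SMulCommClass A Aᵐᵒᵖ C] [Coring A C] [AddCommGroup Q] [Module Aᵐᵒᵖ Q]

/-- The comodule structure `N ⊗_B ρ` on `N ⊗_B Q`, where `B = End^C(Q)`. -/
def tensorCoaction (ρ : Coaction A C Q) (N : Type*) [AddCommGroup N]
    [Module (endRing ρ)ᵐᵒᵖ N] : Coaction A C (NCTensor (endRing ρ) N Q) :=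
  induced ρ (toLin_end_smul ρ) N

/-- The evaluation map `Hom^C(Q, C) ⊗_B Q → C`, where `B = End^C(Q)`. -/
def evaluation (ρ : Coaction A C Q) :
    NCTensor (endRing ρ) (hom ρ (regular A C)) Q →ₗ[Aᵐᵒᵖ] C where
  toFun := lift
    (AddMonoidHom.mk' (fun f => f.1.toAddMonoidHom) (fun f g => rfl))
    (fun f b q => rfl)
  map_add' := map_add _
  map_smul' a x := by
    induction x using NCTensor.induction_on with
    | zero => simp
    | tmul f q => exact f.1.map_smul a q
    | add x y hx hy => simp only [smul_add, map_add, hx, hy]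

/-- `Q` is a Galois comodule: it is finitely generated and projective as a right `A`-module, and
the evaluation map is an isomorphism of right `C`-comodules. -/
structure IsGalois (ρ : Coaction A C Q) : Prop where
  finite : Module.Finite Aᵐᵒᵖ Q
  projective : Module.Projective Aᵐᵒᵖ Q
  colinear : IsColinear (tensorCoaction ρ (hom ρ (regular A C))) (regular A C) (evaluation ρ)
  bijective : Function.Bijective (evaluation ρ)

end Coaction

end

/-!
Faithfully flat Galois descent. The functor `- ⊗_B S` from right `B`-modules to right
`C`-comodules is left adjoint to `Hom^C(S, -)`, and under the hypotheses it is an equivalence; a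
coaction on `N ⊗_B S` is then the same thing as a right `B`-module `P` with
`P ⊗_B S ≃ N ⊗_B S`, and two coactions are isomorphic if and only if the corresponding
modules are.

For the equivalence, the Galois condition and a dual basis of `S` show that
`Hom_A(S, X) ⊗_B S ≃ X ⊗_A S^* ⊗_B S ≃ X ⊗_A C`. For a comodule `(X, F)`, the group
`Hom^C(S, X)` is by definition the kernel of a map `Hom_A(S, X) → Hom_A(S, X ⊗_A C)`, a kernel
preserved by the flat module `S`; comparing it with the coaction `F : X → X ⊗_A C` shows that the
counit `Hom^C(S, X) ⊗_B S → X` is bijective. The unit becomes bijective after tensoring with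
`S`, by a triangle identity, so it is bijective by faithful flatness.
-/

noncomputable section

namespace NCTensor

section Functoriality

variable {R T M M' N N' : Type*} [Ring R] [Ring T]
  [AddCommGroup M] [Module Rᵐᵒᵖ M] [AddCommGroup M'] [Module Rᵐᵒᵖ M']
  [AddCommGroup N] [Module R N] [AddCommGroup N'] [Module R N']

/-- The additive map `f ↦ f ⊗ g`. -/
def mapLeftHom (g : N →ₗ[R] N') :
    (M →ₗ[Rᵐᵒᵖ] M') →+ NCTensor R M N →+ NCTensor R M' N' :=
  AddMonoidHom.mk' (fun f => map f g) fun _ _ => hom_ext fun _ _ => add_tmul _ _ _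

theorem map_zero_left (g : N →ₗ[R] N') : map (0 : M →ₗ[Rᵐᵒᵖ] M') g = 0 :=
  map_zero (mapLeftHom g)

theorem map_add_left (f f' : M →ₗ[Rᵐᵒᵖ] M') (g : N →ₗ[R] N') :
    map (f + f') g = map f g + map f' g :=
  map_add (mapLeftHom g) f f'

theorem map_sub_left (f f' : M →ₗ[Rᵐᵒᵖ] M') (g : N →ₗ[R] N') :
    map (f - f') g = map f g - map f' g :=
  map_sub (mapLeftHom g) f f'

theorem leftInverse_map {f : M →ₗ[Rᵐᵒᵖ] M'} {f' : M' →ₗ[Rᵐᵒᵖ] M} {g : N →ₗ[R] N'}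
    {g' : N' →ₗ[R] N} (hf : Function.LeftInverse f' f) (hg : Function.LeftInverse g' g) :
    Function.LeftInverse (map f' g') (map f g) := fun x => by
  have hf' : f' ∘ₗ f = LinearMap.id := LinearMap.ext hf
  have hg' : g' ∘ₗ g = LinearMap.id := LinearMap.ext hg
  rw [map_map, hf', hg', map_id_id]

theorem map_bijective {f : M →ₗ[Rᵐᵒᵖ] M'} {g : N →ₗ[R] N'} (hf : Function.Bijective f)
    (hg : Function.Bijective g) : Function.Bijective (map f g) := by
  let e := LinearEquiv.ofBijective f hf
  let e' := LinearEquiv.ofBijective g hg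
  exact Function.bijective_iff_has_inverse.2 ⟨map e.symm.toLinearMap e'.symm.toLinearMap,
    leftInverse_map e.left_inv e'.left_inv, leftInverse_map e.right_inv e'.right_inv⟩

variable (T N) in
/-- `e ⊗ N` as a right linear isomorphism. -/
def rTensorEquiv [Module Tᵐᵒᵖ N] [SMulCommClass R Tᵐᵒᵖ N] (e : M ≃ₗ[Rᵐᵒᵖ] M') :
    NCTensor R M N ≃ₗ[Tᵐᵒᵖ] NCTensor R M' N :=
  LinearEquiv.ofBijective (rTensor N e.toLinearMap)
    (map_bijective e.bijective Function.bijective_id)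

variable (R T N) in
/-- The right linear map `n ↦ m ⊗ n`. -/
def tmulRight [Module Tᵐᵒᵖ N] [SMulCommClass R Tᵐᵒᵖ N] (m : M) :
    N →ₗ[Tᵐᵒᵖ] NCTensor R M N where
  toFun := tmul R m
  map_add' := tmul_add m
  map_smul' _ _ := rfl

variable (R N) in
/-- `lid : R ⊗ N → N` as a right linear map. -/
def lidRight [Module Rᵐᵒᵖ N] [SMulCommClass R Rᵐᵒᵖ N] : NCTensor R R N →ₗ[Rᵐᵒᵖ] N where
  toFun := lid
  map_add' := map_add _
  map_smul' t x := by
    induction x using induction_on with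
    | zero => simp only [smul_zero, map_zero]
    | tmul r n => exact smul_comm r t n
    | add x y hx hy => simp only [smul_add, map_add, hx, hy]

end Functoriality

section Flat

variable {B Q X Y : Type u} [Ring B] [AddCommGroup Q] [Module B Q]
  [AddCommGroup X] [AddCommGroup Y] [Module Bᵐᵒᵖ X] [Module Bᵐᵒᵖ Y]

theorem FaithfullyFlat.map_injective_iff (h : FaithfullyFlat B Q) (f : X →ₗ[Bᵐᵒᵖ] Y) :
    Function.Injective (map f (LinearMap.id : Q →ₗ[B] Q)) ↔ Function.Injective f := by
  rw [← LinearMap.exact_zero_iff_injective PUnit.{u + 1} f, h, map_zero_left]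
  exact (LinearMap.exact_zero_iff_injective _ (map f LinearMap.id).toIntLinearMap).symm

theorem FaithfullyFlat.map_surjective_iff (h : FaithfullyFlat B Q) (f : X →ₗ[Bᵐᵒᵖ] Y) :
    Function.Surjective (map f (LinearMap.id : Q →ₗ[B] Q)) ↔ Function.Surjective f := by
  rw [← LinearMap.exact_zero_iff_surjective PUnit.{u + 1} f, h, map_zero_left]
  exact (LinearMap.exact_zero_iff_surjective _ (map f LinearMap.id).toIntLinearMap).symm

theorem FaithfullyFlat.map_bijective_iff (h : FaithfullyFlat B Q) (f : X →ₗ[Bᵐᵒᵖ] Y) :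
    Function.Bijective (map f (LinearMap.id : Q →ₗ[B] Q)) ↔ Function.Bijective f :=
  and_congr (h.map_injective_iff f) (h.map_surjective_iff f)

end Flat

section RightHom

variable {A B S X Y : Type*} [Ring A] [Ring B]
  [AddCommGroup S] [Module B S] [Module Aᵐᵒᵖ S] [SMulCommClass B Aᵐᵒᵖ S]
  [AddCommGroup X] [Module Aᵐᵒᵖ X] [AddCommGroup Y] [Module Aᵐᵒᵖ Y]

/-- For a `(B, A)`-bimodule `S`, the group `Hom_A(S, X)` is a right `B`-module via the action on
`S`. The instance is scoped because it competes with the action of `Bᵐᵒᵖ` on the values if `X`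
is itself a right `B`-module. -/
scoped instance homRightModule : Module Bᵐᵒᵖ (S →ₗ[Aᵐᵒᵖ] X) where
  smul b f := f ∘ₗ DistribSMul.toLinearMap Aᵐᵒᵖ S (unop b)
  one_smul f := LinearMap.ext fun s => congrArg f (one_smul B s)
  mul_smul b c f := LinearMap.ext fun s => congrArg f (mul_smul (unop c) (unop b) s)
  smul_zero _ := rfl
  smul_add _ _ _ := rfl
  add_smul b c f := LinearMap.ext fun s =>
    (congrArg f (add_smul (unop b) (unop c) s)).trans (map_add f _ _)
  zero_smul f := LinearMap.ext fun s => (congrArg f (zero_smul B s)).trans (map_zero f)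

instance : SMulCommClass A Bᵐᵒᵖ (S →ₗ[Aᵐᵒᵖ] A) :=
  ⟨fun _ _ _ => rfl⟩

variable (A B S X) in
/-- The evaluation map `Hom_A(S, X) ⊗_B S → X`. -/
def eval : NCTensor B (S →ₗ[Aᵐᵒᵖ] X) S →ₗ[Aᵐᵒᵖ] X where
  toFun := lift (AddMonoidHom.mk' LinearMap.toAddMonoidHom fun _ _ => rfl) fun _ _ _ => rfl
  map_add' := map_add _
  map_smul' a x := by
    induction x using induction_on with
    | zero => simp only [smul_zero, map_zero]
    | tmul f s => exact f.map_smul a s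
    | add x y hx hy => simp only [smul_add, map_add, hx, hy]

variable (B S) in
/-- Composition with `f : X → Y` as a right `B`-linear map `Hom_A(S, X) → Hom_A(S, Y)`. -/
def postcomp (f : X →ₗ[Aᵐᵒᵖ] Y) : (S →ₗ[Aᵐᵒᵖ] X) →ₗ[Bᵐᵒᵖ] (S →ₗ[Aᵐᵒᵖ] Y) where
  toFun g := f ∘ₗ g
  map_add' g h := LinearMap.comp_add g h f
  map_smul' _ _ := rfl

/-- The right linear map `A → X`, `a ↦ x a`. -/
def orbitMap (A : Type*) [Ring A] {X : Type*} [AddCommGroup X] [Module Aᵐᵒᵖ X] (x : X) :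
    A →ₗ[Aᵐᵒᵖ] X where
  toFun a := op a • x
  map_add' a b := by rw [op_add, add_smul]
  map_smul' a b := by simp [mul_smul]

theorem map_orbitMap {N : Type*} [AddCommGroup N] [Module A N] (x : X) (z : NCTensor A A N) :
    map (orbitMap A x) LinearMap.id z = tmul A x (lid z) := by
  induction z using induction_on with
  | zero => simp only [map_zero, tmul_zero]
  | tmul a n => exact smul_tmul a x n
  | add x y hx hy => simp only [map_add, tmul_add, hx, hy]

variable (A B S X) in
/-- The canonical map `X ⊗_A S^* → Hom_A(S, X)`, `x ⊗ g ↦ (s ↦ x g(s))`, where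
`S^* = Hom_A(S, A)`. -/
def tensorDualHom : NCTensor A X (S →ₗ[Aᵐᵒᵖ] A) →ₗ[Bᵐᵒᵖ] (S →ₗ[Aᵐᵒᵖ] X) where
  toFun := lift
    (AddMonoidHom.mk' (fun x => (postcomp B S (orbitMap A x)).toAddMonoidHom) fun x y => by
      ext g s
      exact smul_add (op (g s)) x y)
    fun x a g => by
      ext s
      exact (mul_smul (op (g s)) (op a) x).symm
  map_add' := map_add _
  map_smul' b x := by
    induction x using induction_on with
    | zero => simp only [smul_zero, map_zero]
    | tmul x g => rfl
    | add x y hx hy => simp only [smul_add, map_add, hx, hy]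

variable (A S) in
theorem exists_finite_dual_basis [Module.Finite Aᵐᵒᵖ S] [Module.Projective Aᵐᵒᵖ S] :
    ∃ (n : ℕ) (e : Fin n → S) (d : Fin n → S →ₗ[Aᵐᵒᵖ] A), ∀ s, ∑ i, op (d i s) • e i = s := by
  obtain ⟨n, p, q, -, -, hpq⟩ := Module.Finite.exists_comp_eq_id_of_projective Aᵐᵒᵖ S
  let unopHom : Aᵐᵒᵖ →ₗ[Aᵐᵒᵖ] A :=
    { toFun := unop, map_add' := fun _ _ => rfl, map_smul' := fun _ _ => rfl }
  exact ⟨n, fun i => p fun j => if i = j then 1 else 0,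
    fun i => unopHom ∘ₗ LinearMap.proj i ∘ₗ q,
    fun s => (p.pi_apply_eq_sum_univ (q s)).symm.trans (DFunLike.congr_fun hpq s)⟩

theorem sum_orbitMap_comp {ι : Type*} [Fintype ι] {e : ι → S} {d : ι → S →ₗ[Aᵐᵒᵖ] A}
    (hed : ∀ s, ∑ i, op (d i s) • e i = s) (f : S →ₗ[Aᵐᵒᵖ] X) :
    ∑ i, orbitMap A (f (e i)) ∘ₗ d i = f := by
  ext s
  calc (∑ i, orbitMap A (f (e i)) ∘ₗ d i) s = ∑ i, op (d i s) • f (e i) :=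
        LinearMap.sum_apply _ _ _
    _ = f (∑ i, op (d i s) • e i) := by simp only [map_sum, map_smul]
    _ = f s := by rw [hed]

theorem tensorDualHom_bijective [Module.Finite Aᵐᵒᵖ S] [Module.Projective Aᵐᵒᵖ S] :
    Function.Bijective (tensorDualHom A B S X) := by
  obtain ⟨n, e, d, hed⟩ := exists_finite_dual_basis A S
  let inv (f : S →ₗ[Aᵐᵒᵖ] X) : NCTensor A X (S →ₗ[Aᵐᵒᵖ] A) := ∑ i, tmul A (f (e i)) (d i)
  refine Function.bijective_iff_has_inverse.2 ⟨inv, fun t => ?_, fun f => ?_⟩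
  · induction t using induction_on with
    | zero => simp only [inv, map_zero, LinearMap.zero_apply, zero_tmul, Finset.sum_const_zero]
    | tmul x g =>
      calc inv (tensorDualHom A B S X (tmul A x g)) = ∑ i, tmul A x (g (e i) • d i) :=
            Finset.sum_congr rfl fun i _ => smul_tmul (g (e i)) x (d i)
        _ = tmul A x (∑ i, orbitMap A (g (e i)) ∘ₗ d i) :=
            (map_sum (AddMonoidHom.mk' (tmul A x) (tmul_add x)) _ _).symm
        _ = tmul A x g := by rw [sum_orbitMap_comp hed]
    | add t u ht hu =>
      simp only [inv, map_add, LinearMap.add_apply, add_tmul, Finset.sum_add_distrib] at ht hu ⊢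
      rw [ht, hu]
  · rw [map_sum]
    exact sum_orbitMap_comp hed f

end RightHom

end NCTensor

open NCTensor Coaction

namespace Coaction

section Comodules

variable {A C X Y Z : Type*} [Ring A] [AddCommGroup C] [Module A C] [Module Aᵐᵒᵖ C]
  [SMulCommClass A Aᵐᵒᵖ C] [Coring A C] [AddCommGroup X] [Module Aᵐᵒᵖ X]
  [AddCommGroup Y] [Module Aᵐᵒᵖ Y] [AddCommGroup Z] [Module Aᵐᵒᵖ Z]
  {F : Coaction A C X} {G : Coaction A C Y} {H : Coaction A C Z}

theorem toLin_injective (F : Coaction A C X) : Function.Injective F.toLin := fun x y h => by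
  rw [← F.counit x, h, F.counit]

theorem IsColinear.comp {g : Y →ₗ[Aᵐᵒᵖ] Z} {f : X →ₗ[Aᵐᵒᵖ] Y} (hg : IsColinear G H g)
    (hf : IsColinear F G f) : IsColinear F H (g ∘ₗ f) := fun x => by
  rw [LinearMap.comp_apply, hg, hf, map_map, LinearMap.id_comp]

theorem IsColinear.symm {f : X ≃ₗ[Aᵐᵒᵖ] Y} (hf : IsColinear F G f.toLinearMap) :
    IsColinear G F f.symm.toLinearMap := f.surjective.forall.2 fun x => by
  have h := hf x
  rw [LinearEquiv.coe_coe] at h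
  rw [LinearEquiv.coe_coe, f.symm_apply_apply, h]
  exact (leftInverse_map f.symm_apply_apply (fun _ => rfl) _).symm

theorem isColinear_pullback (f : X ≃ₗ[Aᵐᵒᵖ] Y) (G : Coaction A C Y) :
    IsColinear (pullback f G) G f.toLinearMap := fun _ =>
  (leftInverse_map f.apply_symm_apply (fun _ => rfl) _).symm

theorem IsColinear.pullback_eq {f : X ≃ₗ[Aᵐᵒᵖ] Y} (hf : IsColinear F G f.toLinearMap) :
    pullback f G = F := by
  ext x
  exact (congrArg _ (hf x)).trans (leftInverse_map f.symm_apply_apply (fun _ => rfl) _)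

/-- Isomorphism of right comodules, for coactions on possibly different modules. -/
def IsIsomorphic (F : Coaction A C X) (G : Coaction A C Y) : Prop :=
  ∃ f : X ≃ₗ[Aᵐᵒᵖ] Y, IsColinear F G f.toLinearMap

theorem IsIsomorphic.symm : IsIsomorphic F G → IsIsomorphic G F := fun ⟨f, hf⟩ =>
  ⟨f.symm, hf.symm⟩

theorem IsIsomorphic.trans : IsIsomorphic F G → IsIsomorphic G H → IsIsomorphic F H :=
  fun ⟨f, hf⟩ ⟨g, hg⟩ => ⟨f.trans g, hg.comp hf⟩

theorem isIsomorphic_pullback (f : X ≃ₗ[Aᵐᵒᵖ] Y) (G : Coaction A C Y) :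
    IsIsomorphic (pullback f G) G :=
  ⟨f, isColinear_pullback f G⟩

/-- A comodule isomorphism `X ≃ Y` induces `Hom^C(S, X) ≃ Hom^C(S, Y)`. -/
def homCongr {S : Type*} [AddCommGroup S] [Module Aᵐᵒᵖ S] (ρ : Coaction A C S)
    (f : X ≃ₗ[Aᵐᵒᵖ] Y) (hf : IsColinear F G f.toLinearMap) :
    hom ρ F ≃ₗ[(endRing ρ)ᵐᵒᵖ] hom ρ G where
  toFun g := ⟨f.toLinearMap ∘ₗ g.1, hf.comp g.2⟩
  invFun g := ⟨f.symm.toLinearMap ∘ₗ g.1, hf.symm.comp g.2⟩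
  left_inv g := Subtype.ext (LinearMap.ext fun s => f.symm_apply_apply (g.1 s))
  right_inv g := Subtype.ext (LinearMap.ext fun s => f.apply_symm_apply (g.1 s))
  map_add' g h := Subtype.ext (LinearMap.comp_add g.1 h.1 f.toLinearMap)
  map_smul' _ _ := rfl

end Comodules

section Induced

variable {A B C Q X : Type*} [Ring A] [Ring B] [AddCommGroup C] [Module A C] [Module Aᵐᵒᵖ C]
  [SMulCommClass A Aᵐᵒᵖ C] [Coring A C]
  [AddCommGroup Q] [Module B Q] [Module Aᵐᵒᵖ Q] [SMulCommClass B Aᵐᵒᵖ Q]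
  [AddCommGroup X] [Module Aᵐᵒᵖ X]
  {N N' : Type*} [AddCommGroup N] [Module Bᵐᵒᵖ N] [AddCommGroup N'] [Module Bᵐᵒᵖ N']
  {ρ : Coaction A C Q} (hρ : ∀ (b : B) (q : Q), ρ.toLin (b • q) = b • ρ.toLin q)

theorem isColinear_tmulRight (n : N) : IsColinear ρ (induced ρ hρ N) (tmulRight B A Q n) :=
  fun q => by
    change (assoc B A N Q C).symm (tmul B n (ρ.toLin q)) = _
    induction ρ.toLin q using NCTensor.induction_on with
    | zero => simp only [tmul_zero, map_zero]
    | tmul q c => rfl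
    | add x y hx hy => simp only [tmul_add, map_add, hx, hy]

theorem isColinear_induced {F : Coaction A C X} {f : NCTensor B N Q →ₗ[Aᵐᵒᵖ] X}
    (hf : ∀ n, IsColinear ρ F (f ∘ₗ tmulRight B A Q n)) : IsColinear (induced ρ hρ N) F f :=
  fun x => by
    induction x using NCTensor.induction_on with
    | zero => simp only [map_zero]
    | tmul n q =>
      calc F.toLin (f (tmul B n q)) = map (f ∘ₗ tmulRight B A Q n) LinearMap.id (ρ.toLin q) :=
            hf n q
        _ = map f LinearMap.id (map (tmulRight B A Q n) LinearMap.id (ρ.toLin q)) := by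
            rw [map_map, LinearMap.id_comp]
        _ = map f LinearMap.id ((induced ρ hρ N).toLin (tmul B n q)) :=
            congrArg _ (isColinear_tmulRight hρ n q).symm
    | add x y hx hy => simp only [map_add, hx, hy]

theorem isColinear_rTensor (f : N →ₗ[Bᵐᵒᵖ] N') :
    IsColinear (induced ρ hρ N) (induced ρ hρ N') (rTensor Q f) :=
  isColinear_induced hρ fun n => isColinear_tmulRight hρ (f n)

theorem isIsomorphic_induced (e : N ≃ₗ[Bᵐᵒᵖ] N') :
    IsIsomorphic (induced ρ hρ N) (induced ρ hρ N') :=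
  ⟨rTensorEquiv A Q e, isColinear_rTensor hρ e.toLinearMap⟩

end Induced

section Cofree

variable {A C S : Type*} [Ring A] [AddCommGroup C] [Module A C] [Module Aᵐᵒᵖ C]
  [SMulCommClass A Aᵐᵒᵖ C] [Coring A C] [AddCommGroup S] [Module Aᵐᵒᵖ S]
  (ρ : Coaction A C S) {X Y : Type*} [AddCommGroup X] [Module Aᵐᵒᵖ X]
  [AddCommGroup Y] [Module Aᵐᵒᵖ Y]

theorem toLin_regular_smul (a : A) (c : C) :
    (regular A C).toLin (a • c) = a • (regular A C).toLin c :=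
  Coring.comul.left.map_smul a c

variable (A C X) in
/-- The cofree comodule `X ⊗_A C`, with coaction `X ⊗ Δ`. -/
def cofree : Coaction A C (NCTensor A X C) :=
  induced (regular A C) toLin_regular_smul X

theorem isColinear_toLin (F : Coaction A C X) : IsColinear F (cofree A C X) F.toLin := fun x =>
  (AddEquiv.symm_apply_eq _).2 (F.coassoc x).symm

theorem isColinear_lidRight : IsColinear (cofree A C A) (regular A C) (lidRight A C) :=
  isColinear_induced toLin_regular_smul fun a c => toLin_regular_smul a c

variable (X) in
/-- The map `f ↦ (f ⊗ C) ∘ ρ` from `Hom_A(S, X)` to `Hom_A(S, X ⊗_A C)`. Its values are the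
comodule homomorphisms from `S` to the cofree comodule on `X`. -/
def cofreeLift : (S →ₗ[Aᵐᵒᵖ] X) →ₗ[(endRing ρ)ᵐᵒᵖ] (S →ₗ[Aᵐᵒᵖ] NCTensor A X C) where
  toFun f := rTensor C f ∘ₗ ρ.toLin
  map_add' f g := LinearMap.ext fun s => DFunLike.congr_fun (map_add_left f g _) (ρ.toLin s)
  map_smul' b f := LinearMap.ext fun s => by
    calc map (f ∘ₗ (unop b).1) LinearMap.id (ρ.toLin s)
        = map f LinearMap.id (map (unop b).1 LinearMap.id (ρ.toLin s)) := by
          rw [map_map, LinearMap.id_comp]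
      _ = map f LinearMap.id (ρ.toLin ((unop b).1 s)) := by rw [(unop b).2 s]

theorem isColinear_cofreeLift (f : S →ₗ[Aᵐᵒᵖ] X) :
    IsColinear ρ (cofree A C X) (cofreeLift ρ X f) :=
  (isColinear_rTensor toLin_regular_smul f).comp (isColinear_toLin ρ)

theorem cofreeLift_comp (f : X →ₗ[Aᵐᵒᵖ] Y) (g : S →ₗ[Aᵐᵒᵖ] X) :
    cofreeLift ρ Y (f ∘ₗ g) = rTensor C f ∘ₗ cofreeLift ρ X g :=
  LinearMap.ext fun s => (map_map f LinearMap.id g LinearMap.id (ρ.toLin s)).symm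

variable (X) in
/-- The map `Hom_A(S, X) ⊗_B S → X ⊗_A C`, `f ⊗ s ↦ (f ⊗ C)(ρ s)`, where `B = End^C(S)`. -/
def cofreeEval : NCTensor (endRing ρ) (S →ₗ[Aᵐᵒᵖ] X) S →ₗ[Aᵐᵒᵖ] NCTensor A X C :=
  eval A (endRing ρ) S (NCTensor A X C) ∘ₗ rTensor S (cofreeLift ρ X)

theorem cofreeEval_postcomp (f : X →ₗ[Aᵐᵒᵖ] Y) (t : NCTensor (endRing ρ) (S →ₗ[Aᵐᵒᵖ] X) S) :
    cofreeEval ρ Y (map (postcomp (endRing ρ) S f) LinearMap.id t)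
      = map f LinearMap.id (cofreeEval ρ X t) := by
  induction t using NCTensor.induction_on with
  | zero => simp only [map_zero]
  | tmul g s => exact DFunLike.congr_fun (cofreeLift_comp ρ f g) s
  | add x y hx hy => simp only [map_add, hx, hy]

theorem cofreeEval_cofreeLift (t : NCTensor (endRing ρ) (S →ₗ[Aᵐᵒᵖ] X) S) :
    cofreeEval ρ (NCTensor A X C) (map (cofreeLift ρ X) LinearMap.id t)
      = (cofree A C X).toLin (cofreeEval ρ X t) := by
  induction t using NCTensor.induction_on with
  | zero => simp only [map_zero]
  | tmul g s => exact (isColinear_cofreeLift ρ g s).symm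
  | add x y hx hy => simp only [map_add, hx, hy]

end Cofree

section Galois

variable {A C S X : Type*} [Ring A] [AddCommGroup C] [Module A C] [Module Aᵐᵒᵖ C]
  [SMulCommClass A Aᵐᵒᵖ C] [Coring A C] [AddCommGroup S] [Module Aᵐᵒᵖ S]
  [AddCommGroup X] [Module Aᵐᵒᵖ X] (ρ : Coaction A C S)

theorem counit_lid_cofreeLift (g : S →ₗ[Aᵐᵒᵖ] A) (s : S) :
    (Coring.counit (A := A) (C := C)).left (lid (cofreeLift ρ A g s)) = g s := by
  conv_rhs => rw [← ρ.counit s]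
  change (Coring.counit (A := A) (C := C)).left (lid (map g LinearMap.id (ρ.toLin s))) = _
  induction ρ.toLin s using NCTensor.induction_on with
  | zero => simp only [map_zero]
  | tmul s c =>
    exact (map_smul Coring.counit.left (g s) c).trans
      (g.map_smul (op (Coring.counit.left c)) s).symm
  | add x y hx hy => simp only [map_add, hx, hy]

/-- The isomorphism `Hom_A(S, A) ≃ Hom^C(S, C)`, `g ↦ (g ⊗ C) ∘ ρ`, which identifies `A ⊗_A C`
with `C`. -/
def dualEquiv : (S →ₗ[Aᵐᵒᵖ] A) ≃ₗ[(endRing ρ)ᵐᵒᵖ] hom ρ (regular A C) where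
  toFun g := ⟨lidRight A C ∘ₗ cofreeLift ρ A g,
    isColinear_lidRight.comp (isColinear_cofreeLift ρ g)⟩
  invFun f := Coring.counit.right ∘ₗ f.1
  left_inv g := LinearMap.ext (counit_lid_cofreeLift ρ g)
  right_inv f := Subtype.ext <| LinearMap.ext fun s =>
    calc lid (cofreeLift ρ A (Coring.counit.right ∘ₗ f.1) s)
        = lid (map Coring.counit.right LinearMap.id (map f.1 LinearMap.id (ρ.toLin s))) := by
          rw [cofreeLift_comp]
          rfl
      _ = lid (map Coring.counit.right LinearMap.id (Coring.comul.left (f.1 s))) := by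
          rw [← f.2 s]
          rfl
      _ = f.1 s := Coring.counit_left (f.1 s)
  map_add' g h := Subtype.ext
    (map_add (postcomp (endRing ρ) S (lidRight A C) ∘ₗ cofreeLift ρ A) g h)
  map_smul' b g := Subtype.ext
    (map_smul (postcomp (endRing ρ) S (lidRight A C) ∘ₗ cofreeLift ρ A) b g)

/-- The map `Hom_A(S, A) ⊗_B S → C`, `g ⊗ s ↦ (g ⊗ C)(ρ s)`, where `B = End^C(S)`. Up to
`dualEquiv` it is the evaluation map in the Galois condition. -/
def dualEval : NCTensor (endRing ρ) (S →ₗ[Aᵐᵒᵖ] A) S →ₗ[A] C where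
  toFun t := lid (cofreeEval ρ A t)
  map_add' t u := by simp only [map_add]
  map_smul' a t :=
    calc lid (cofreeEval ρ A (a • t))
        = lid (map (orbitMap A a) LinearMap.id (cofreeEval ρ A t)) :=
          congrArg lid (cofreeEval_postcomp ρ (orbitMap A a) t)
      _ = a • lid (cofreeEval ρ A t) := by rw [map_orbitMap, lid_tmul]

theorem evaluation_map_dualEquiv (t : NCTensor (endRing ρ) (S →ₗ[Aᵐᵒᵖ] A) S) :
    evaluation ρ (map (dualEquiv ρ).toLinearMap LinearMap.id t) = dualEval ρ t := by
  induction t using NCTensor.induction_on with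
  | zero => simp only [map_zero]
  | tmul g s => rfl
  | add x y hx hy => simp only [map_add, hx, hy]

variable {ρ} in
theorem dualEval_bijective (hev : Function.Bijective (evaluation ρ)) :
    Function.Bijective (dualEval ρ) := by
  rw [← funext (evaluation_map_dualEquiv ρ)]
  exact hev.comp (map_bijective (dualEquiv ρ).bijective Function.bijective_id)

theorem cofreeEval_map_tensorDualHom
    (t : NCTensor (endRing ρ) (NCTensor A X (S →ₗ[Aᵐᵒᵖ] A)) S) :
    cofreeEval ρ X (map (tensorDualHom A (endRing ρ) S X) LinearMap.id t)
      = map LinearMap.id (dualEval ρ) (assoc A (endRing ρ) X (S →ₗ[Aᵐᵒᵖ] A) S t) := by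
  refine DFunLike.congr_fun (assoc_ext
    (f := (cofreeEval ρ X).toAddMonoidHom.comp (map (tensorDualHom A (endRing ρ) S X) LinearMap.id))
    (g := (map LinearMap.id (dualEval ρ)).comp
      (assoc A (endRing ρ) X (S →ₗ[Aᵐᵒᵖ] A) S).toAddMonoidHom) fun x g s => ?_) t
  exact (cofreeEval_postcomp ρ (orbitMap A x) (tmul _ g s)).trans (map_orbitMap x _)

variable {ρ} in
theorem cofreeEval_bijective [Module.Finite Aᵐᵒᵖ S] [Module.Projective Aᵐᵒᵖ S]
    (hev : Function.Bijective (evaluation ρ)) : Function.Bijective (cofreeEval ρ X) := by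
  have h_dual : Function.Bijective (map (tensorDualHom A (endRing ρ) S X)
      (LinearMap.id : S →ₗ[endRing ρ] S)) :=
    map_bijective tensorDualHom_bijective Function.bijective_id
  refine (h_dual.of_comp_iff (cofreeEval ρ X)).1 ?_
  rw [show cofreeEval ρ X ∘ map (tensorDualHom A (endRing ρ) S X) LinearMap.id = _ from
    funext (cofreeEval_map_tensorDualHom ρ)]
  exact (map_bijective Function.bijective_id (dualEval_bijective hev)).comp (AddEquiv.bijective _)

end Galois

section Adjunction

variable {A C S X : Type*} [Ring A] [AddCommGroup C] [Module A C] [Module Aᵐᵒᵖ C]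
  [SMulCommClass A Aᵐᵒᵖ C] [Coring A C] [AddCommGroup S] [Module Aᵐᵒᵖ S]
  [AddCommGroup X] [Module Aᵐᵒᵖ X] (ρ : Coaction A C S) (F : Coaction A C X)

/-- The inclusion `Hom^C(S, X) → Hom_A(S, X)` as a right `End^C(S)`-linear map. -/
def homIncl : hom ρ F →ₗ[(endRing ρ)ᵐᵒᵖ] (S →ₗ[Aᵐᵒᵖ] X) where
  toFun := Subtype.val
  map_add' _ _ := rfl
  map_smul' _ _ := rfl

theorem exact_homIncl :
    Function.Exact (homIncl ρ F) (postcomp (endRing ρ) S F.toLin - cofreeLift ρ X) := fun f => by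
  rw [LinearMap.sub_apply, sub_eq_zero]
  refine ⟨fun hf => ⟨⟨f, DFunLike.congr_fun hf⟩, rfl⟩, ?_⟩
  rintro ⟨g, rfl⟩
  exact LinearMap.ext g.2

/-- The evaluation map `Hom^C(S, X) ⊗_B S → X`, where `B = End^C(S)`: the counit of the
adjunction between `- ⊗_B S` and `Hom^C(S, -)`. -/
def homEval : NCTensor (endRing ρ) (hom ρ F) S →ₗ[Aᵐᵒᵖ] X :=
  eval A (endRing ρ) S X ∘ₗ rTensor S (homIncl ρ F)

theorem isColinear_homEval : IsColinear (tensorCoaction ρ (hom ρ F)) F (homEval ρ F) :=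
  isColinear_induced (toLin_end_smul ρ) Subtype.prop

theorem cofreeEval_map_homIncl (t : NCTensor (endRing ρ) (hom ρ F) S) :
    cofreeEval ρ X (map (homIncl ρ F) LinearMap.id t) = F.toLin (homEval ρ F t) := by
  induction t using NCTensor.induction_on with
  | zero => simp only [map_zero]
  | tmul g s => exact (g.2 s).symm
  | add x y hx hy => simp only [map_add, hx, hy]

/-- The map `P → Hom^C(S, P ⊗_B S)`, `p ↦ p ⊗ -`, where `B = End^C(S)`: the unit of the
adjunction between `- ⊗_B S` and `Hom^C(S, -)`. -/
def homUnit (P : Type*) [AddCommGroup P] [Module (endRing ρ)ᵐᵒᵖ P] :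
    P →ₗ[(endRing ρ)ᵐᵒᵖ] hom ρ (tensorCoaction ρ P) where
  toFun p := ⟨tmulRight (endRing ρ) A S p, isColinear_tmulRight (toLin_end_smul ρ) p⟩
  map_add' p q := Subtype.ext (LinearMap.ext (add_tmul p q))
  map_smul' b p := Subtype.ext (LinearMap.ext (smul_tmul (unop b) p))

theorem homEval_map_homUnit {P : Type*} [AddCommGroup P] [Module (endRing ρ)ᵐᵒᵖ P]
    (t : NCTensor (endRing ρ) P S) :
    homEval ρ (tensorCoaction ρ P) (map (homUnit ρ P) LinearMap.id t) = t := by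
  induction t using NCTensor.induction_on with
  | zero => simp only [map_zero]
  | tmul p s => rfl
  | add x y hx hy => simp only [map_add, hx, hy]

end Adjunction

section Equivalence

variable {A C S X P P' : Type u} [Ring A] [AddCommGroup C] [Module A C] [Module Aᵐᵒᵖ C]
  [SMulCommClass A Aᵐᵒᵖ C] [Coring A C] [AddCommGroup S] [Module Aᵐᵒᵖ S]
  [AddCommGroup X] [Module Aᵐᵒᵖ X] {ρ : Coaction A C S}
  [AddCommGroup P] [Module (endRing ρ)ᵐᵒᵖ P] [AddCommGroup P'] [Module (endRing ρ)ᵐᵒᵖ P']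

theorem homEval_bijective (hG : ρ.IsGalois) (hflat : FaithfullyFlat (endRing ρ) S)
    (F : Coaction A C X) : Function.Bijective (homEval ρ F) := by
  have := hG.finite
  have := hG.projective
  have h_exact := (hflat _ _ _ _ _).1 (exact_homIncl ρ F)
  have h_incl : Function.Injective (map (homIncl ρ F) (LinearMap.id : S →ₗ[endRing ρ] S)) :=
    (hflat.map_injective_iff _).2 Subtype.val_injective
  refine ⟨fun t u htu => h_incl ((cofreeEval_bijective hG.bijective).injective ?_), fun x => ?_⟩
  · rw [cofreeEval_map_homIncl, cofreeEval_map_homIncl, htu]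
  · obtain ⟨t, ht⟩ := (cofreeEval_bijective hG.bijective).surjective (F.toLin x)
    have h_ker : map (postcomp (endRing ρ) S F.toLin - cofreeLift ρ X) LinearMap.id t = 0 := by
      rw [map_sub_left, AddMonoidHom.sub_apply, sub_eq_zero]
      apply (cofreeEval_bijective hG.bijective).injective
      rw [cofreeEval_postcomp, cofreeEval_cofreeLift, ht]
      exact (isColinear_toLin F x).symm
    obtain ⟨u, rfl⟩ := (h_exact t).1 h_ker
    exact ⟨u, F.toLin_injective ((cofreeEval_map_homIncl ρ F u).symm.trans ht)⟩

theorem homUnit_bijective (hG : ρ.IsGalois) (hflat : FaithfullyFlat (endRing ρ) S) :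
    Function.Bijective (homUnit ρ P) := by
  rw [← hflat.map_bijective_iff, ← (homEval_bijective hG hflat _).of_comp_iff']
  rw [show homEval ρ (tensorCoaction ρ P) ∘ map (homUnit ρ P) LinearMap.id = id from
    funext (homEval_map_homUnit ρ)]
  exact Function.bijective_id

theorem isIsomorphic_tensorCoaction_iff (hG : ρ.IsGalois)
    (hflat : FaithfullyFlat (endRing ρ) S) :
    IsIsomorphic (tensorCoaction ρ P) (tensorCoaction ρ P')
      ↔ Nonempty (P ≃ₗ[(endRing ρ)ᵐᵒᵖ] P') := by
  refine ⟨fun ⟨f, hf⟩ => ?_, fun ⟨e⟩ => isIsomorphic_induced (toLin_end_smul ρ) e⟩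
  let unitEquiv := LinearEquiv.ofBijective (homUnit ρ P) (homUnit_bijective hG hflat)
  let unitEquiv' := LinearEquiv.ofBijective (homUnit ρ P') (homUnit_bijective hG hflat)
  exact ⟨unitEquiv.trans ((homCongr ρ f hf).trans unitEquiv'.symm)⟩

end Equivalence

end Coaction

theorem DescentD1.mk_eq_mk_iff {A C X : Type*} [Ring A] [AddCommGroup C] [Module A C]
    [Module Aᵐᵒᵖ C] [SMulCommClass A Aᵐᵒᵖ C] [Coring A C] [AddCommGroup X] [Module Aᵐᵒᵖ X]
    {F G : Coaction A C X} :
    mk F = mk G ↔ IsIsomorphic F G := by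
  refine Quotient.eq.trans ⟨?_, fun ⟨f, hf⟩ => ⟨op f, hf.pullback_eq⟩⟩
  rintro ⟨f, rfl⟩
  exact isIsomorphic_pullback (unop f) G

section Twist

variable {A C S N : Type u} [Ring A] [AddCommGroup C] [Module A C] [Module Aᵐᵒᵖ C]
  [SMulCommClass A Aᵐᵒᵖ C] [Coring A C] [AddCommGroup S] [Module Aᵐᵒᵖ S]
  {ρ : Coaction A C S} [AddCommGroup N] [Module (endRing ρ)ᵐᵒᵖ N]

/-- The coaction on `N ⊗_B S` transported from the induced coaction on `P ⊗_B S` along the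
isomorphism of a twisted form `P`, where `B = End^C(S)`. -/
def TwistedForm.coaction (P : TwistedForm A (endRing ρ) S N) :
    Coaction A C (NCTensor (endRing ρ) N S) :=
  pullback P.iso.symm (tensorCoaction ρ P.carrier)

theorem TwistedForm.mk_coaction_eq_iff (P P' : TwistedForm A (endRing ρ) S N) :
    DescentD1.mk P.coaction = DescentD1.mk P'.coaction ↔
      IsIsomorphic (tensorCoaction ρ P.carrier) (tensorCoaction ρ P'.carrier) := by
  have hP : IsIsomorphic P.coaction (tensorCoaction ρ P.carrier) := isIsomorphic_pullback _ _
  have hP' : IsIsomorphic P'.coaction (tensorCoaction ρ P'.carrier) := isIsomorphic_pullback _ _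
  rw [DescentD1.mk_eq_mk_iff]
  exact ⟨fun h => hP.symm.trans (h.trans hP'), fun h => hP.trans (h.trans hP'.symm)⟩

/-- The map sending the class of a twisted form to the class of its coaction. -/
def Twist.toDescentD1 : Twist A (endRing ρ) S N → DescentD1 A C (NCTensor (endRing ρ) N S) :=
  Quotient.lift (fun P => DescentD1.mk P.coaction) fun P P' ⟨e⟩ =>
    (P.mk_coaction_eq_iff P').2 (isIsomorphic_induced (toLin_end_smul ρ) e)

theorem Twist.toDescentD1_point :
    toDescentD1 (point A (endRing ρ) S N) = DescentD1.mk (tensorCoaction ρ N) :=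
  DescentD1.mk_eq_mk_iff.2 (isIsomorphic_pullback _ _)

theorem Twist.toDescentD1_bijective (hG : ρ.IsGalois) (hflat : FaithfullyFlat (endRing ρ) S) :
    Function.Bijective (toDescentD1 : Twist A (endRing ρ) S N → _) := by
  constructor
  · rintro ⟨P⟩ ⟨P'⟩ h
    exact Quotient.sound
      ((isIsomorphic_tensorCoaction_iff hG hflat).1 ((P.mk_coaction_eq_iff P').1 h))
  · rintro ⟨F⟩
    let evalEquiv := LinearEquiv.ofBijective (homEval ρ F) (homEval_bijective hG hflat F)
    have h_eval : IsColinear (tensorCoaction ρ (hom ρ F)) F evalEquiv.toLinearMap :=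
      isColinear_homEval ρ F
    exact ⟨Quotient.mk _ ⟨hom ρ F, evalEquiv⟩, congrArg DescentD1.mk h_eval.symm.pullback_eq⟩

end Twist

end

theorem theorem2p4 {A C S : Type u} [Ring A]
    [AddCommGroup C] [Module A C] [Module Aᵐᵒᵖ C] [SMulCommClass A Aᵐᵒᵖ C] [Coring A C]
    [AddCommGroup S] [Module Aᵐᵒᵖ S] (ρ : Coaction A C S)
    (hGalois : ρ.IsGalois) (hflat : NCTensor.FaithfullyFlat ρ.endRing S)
    (N : Type u) [AddCommGroup N] [Module (ρ.endRing)ᵐᵒᵖ N] :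
    ∃ e : DescentD1 A C (NCTensor ρ.endRing N S) ≃ Twist A ρ.endRing S N,
      e (DescentD1.mk (ρ.tensorCoaction N)) = Twist.point A ρ.endRing S N := by
  let e := Equiv.ofBijective _ (Twist.toDescentD1_bijective (N := N) hGalois hflat)
  exact ⟨e.symm, e.symm_apply_eq.2 Twist.toDescentD1_point.symm⟩
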